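/- All groups are finite and all characters are complex. For a group $G$ and a subgroup $K$, say that $(G,K)$ satisfies $(*)$ if there exist an element $g\in G\setminus \mathrm{Z}(G)$ and a nonlinear irreducible character $\chi$ of $G$ such that $\chi(g)\neq 0$, every nonlinear irreducible character $\psi\neq\chi$ of $G$ satisfies $\psi(g)=0$, and $K=\ker\chi=\{x\in G:\chi(x)=\chi(1)\}$. A group $X$ is a Frobenius group with Frobenius kernel $N$ if $N$ is a nontrivial normal subgroup of $X$ that has a nontrivial complement $H$ in $X$ such that no nontrivial element of $H$ commutes with a nontrivial element of $N$. Let $G$ be a finite group, $G'$ its commutator subgroup, $K$ a normal subgroup of $G$, and $p$ a prime. (a) Suppose that $(G,K)$ satisfies $(*)$, that $K\neq 1$ is a $p'$-group (that is, $p\nmid |K|$), that $G/K$ is a Frobenius group whose Frobenius kernel $G'/K$ is an elementary abelian $p$-group of order $p^m$ for an integer $m\geq 1$, and that $G/G'$ is cyclic of order $p^m-1$. Then $G$ is a $2$-Frobenius group: $G'$ is a Frobenius group with Frobenius kernel $K$, and $G/K$ is a Frobenius group with Frobenius kernel $G'/K$. Moreover, $m=1$. (b) Conversely, suppose that $K\leq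 G'$, that $G'$ is a Frobenius group with Frobenius kernel $K$, that $G/K$ is a Frobenius group with Frobenius kernel $G'/K$, that $|G':K|=p$, and that $G/G'$ is cyclic of order $p-1$. Then $(G,K)$ satisfies $(*)$. -/

import Mathlib

/-- `χ : G → ℂ` is the character of an irreducible finite-dimensional complex representation
of `G`. (Every finite-dimensional complex space is isomorphic to some `Fin n → ℂ`.) -/
def IsIrrChar {G : Type*} [Group G] (χ : G → ℂ) : Prop :=
  ∃ (n : ℕ) (ρ : Representation ℂ G (Fin n → ℂ)), ρ.IsIrreducible ∧ ρ.character = χ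

/-- `χ` is a nonlinear irreducible character: its degree `χ 1` is not `1`. -/
def IsNonlinearIrrChar {G : Type*} [Group G] (χ : G → ℂ) : Prop :=
  IsIrrChar χ ∧ χ 1 ≠ 1

/-- There are a noncentral element `g` and a nonlinear irreducible character `χ` with `χ g ≠ 0`
such that every other nonlinear irreducible character vanishes at `g`, and
`K` is the kernel `{x | χ x = χ 1}` of `χ`. -/
def IsolatedCharWithKernel (G : Type*) [Group G] (K : Subgroup G) : Prop :=
  ∃ (g : G) (χ : G → ℂ), g ∉ Subgroup.center G ∧ IsNonlinearIrrChar χ ∧ χ g ≠ 0 ∧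
    (∀ ψ : G → ℂ, IsNonlinearIrrChar ψ → ψ ≠ χ → ψ g = 0) ∧
    ∀ x : G, x ∈ K ↔ χ x = χ 1

/-- `G` is a Frobenius group with Frobenius kernel `N`: `G = N H` with `N` normal, `N ∩ H = 1`,
`N` and `H` nontrivial, and no nontrivial element of `H` centralizes a nontrivial element
of `N`. -/
def IsFrobeniusWithKernel {G : Type*} [Group G] (N : Subgroup G) : Prop :=
  N.Normal ∧ N ≠ ⊥ ∧ ∃ H : Subgroup G, H ≠ ⊥ ∧ N.IsComplement' H ∧
    ∀ h ∈ H, h ≠ 1 → ∀ n ∈ N, h * n = n * h → n = 1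

/-- `G` is a `2`-Frobenius group with respect to the normal subgroups `K ≤ L`: `L` is a Frobenius
group with kernel `K`, and `G / K` is a Frobenius group with kernel `L / K`. -/
def IsTwoFrobenius {G : Type*} [Group G] (K L : Subgroup G) [K.Normal] : Prop :=
  L.Normal ∧ K ≤ L ∧ IsFrobeniusWithKernel (K.subgroupOf L) ∧
    IsFrobeniusWithKernel (L.map (QuotientGroup.mk' K))

/-- `E` is an elementary abelian `p`-group. -/
def IsElementaryAbelian (p : ℕ) (E : Type*) [Group E] : Prop :=
  (∀ a b : E, a * b = b * a) ∧ ∀ a : E, a ^ p = 1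

/-!
Suppose that `χ` is isolated at `g ≠ 1`, and compare the columns of `g` and of another element `y`
in the character table. The linear characters contribute `|G : G'|` if `g y⁻¹ ∈ G'` and `0`
otherwise, and `χ` is the only nonlinear character that contributes, so

  `[g y⁻¹ ∈ G'] |G : G'| + χ(g) χ(y⁻¹) = [y ∼ g] |C(y)|`.

Taking `y = 1` and then `y` arbitrary shows that `g ∈ G'` and that `G' ∖ ker χ` is the conjugacy
class of `g`. If moreover `|G : G'| + 1 = |G' : K|` for `K = ker χ`, counting gives
`|C(x)| = |G' : K|` for every `x ∈ G' ∖ K`. In part (a) this is prime to `|K|`, so no such `x`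
commutes with a nontrivial element of `K`, and a complement of `K` in `G'` acts
fixed-point-freely on `K`. An elementary abelian group with such an action is cyclic, whence
`m = 1`.

Conversely, let `g` be a nontrivial element of a complement `C` of `K` in `G'`. The two Frobenius
conditions give `|C(g)| ≤ |G' : K| = |G : G'| + 1`, hence `G' ∖ K` is again the class of `g`. All
nontrivial elements of `C` are then conjugate to `g`, so characters take integral values at `g`,
and `g` is conjugate to `g⁻¹`. Column orthogonality for `g` with itself now says that the squares of
the values at `g` of the nonlinear characters add up to at most `1`: just one of them is nonzero.
-/

open scoped MonoidAlgebra

section IrreducibleRepresentations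

variable {k G V W : Type*} [Field k] [Group G] [AddCommGroup V] [Module k V] [AddCommGroup W]
  [Module k W]

theorem isIrreducible_of_equiv {ρ : Representation k G V} {σ : Representation k G W}
    (e : ρ.Equiv σ) (hρ : ρ.IsIrreducible) : σ.IsIrreducible := by
  rw [Representation.irreducible_iff_isSimpleModule_asModule] at hρ ⊢
  let f := Representation.IntertwiningMap.equivLinearMapAsModule σ ρ e.symm.toIntertwiningMap
  have hf : Function.Bijective f := e.symm.toLinearEquiv.bijective
  exact IsSimpleModule.congr (LinearEquiv.ofBijective f hf)

theorem nontrivial_of_isIrreducible {ρ : Representation k G V} (hρ : ρ.IsIrreducible) :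
    Nontrivial V :=
  have : IsSimpleModule k[G] ρ.asModule :=
    (Representation.irreducible_iff_isSimpleModule_asModule ρ).1 hρ
  IsSimpleModule.nontrivial k[G] ρ.asModule

theorem isIrreducible_of_finrank_eq_one {ρ : Representation k G V}
    (h : Module.finrank k V = 1) : ρ.IsIrreducible := by
  have : IsSimpleOrder (Submodule k V) := is_simple_module_of_finrank_eq_one h
  have hnontrivial : Nontrivial (Subrepresentation ρ) :=
    ⟨⊥, ⊤, fun h => bot_ne_top (congrArg Subrepresentation.toSubmodule h)⟩
  exact ⟨fun U => (eq_bot_or_eq_top U.toSubmodule).imp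
    (fun h => Subrepresentation.toSubmodule_injective h)
    (fun h => Subrepresentation.toSubmodule_injective h)⟩

theorem asAlgebraHom_eq_zero_of_trace_eq_zero [IsAlgClosed k] [CharZero k] [FiniteDimensional k V]
    {ρ : Representation k G V} (hρ : ρ.IsIrreducible) {z : k[G]} (hz : ∀ a, Commute z a)
    (htrace : LinearMap.trace k V (ρ.asAlgebraHom z) = 0) : ρ.asAlgebraHom z = 0 := by
  let f : ρ.IntertwiningMap ρ :=
    { toLinearMap := ρ.asAlgebraHom z
      isIntertwining' := fun g => by
        rw [← Representation.asAlgebraHom_of]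
        exact ((hz _).map ρ.asAlgebraHom).eq }
  obtain ⟨c, hc⟩ :=
    Representation.IsIrreducible.algebraMap_intertwiningMap_bijective_of_isAlgClosed.2 f
  have hscalar : ρ.asAlgebraHom z = c • LinearMap.id :=
    (congrArg Representation.IntertwiningMap.toLinearMap hc).symm
  have := nontrivial_of_isIrreducible hρ
  have hdim : (Module.finrank k V : k) ≠ 0 := Nat.cast_ne_zero.2 Module.finrank_pos.ne'
  rw [hscalar, map_smul, LinearMap.trace_id, smul_eq_mul] at htrace
  rw [hscalar, (mul_eq_zero.1 htrace).resolve_right hdim, zero_smul]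

variable (k G) in
theorem asAlgebraHom_ofModule' (M : Type*) [AddCommMonoid M] [Module k M] [Module k[G] M]
    [IsScalarTower k k[G] M] :
    (Representation.ofModule' (k := k) (G := G) M).asAlgebraHom = Algebra.lsmul k k M :=
  (MonoidAlgebra.lift k (Module.End k M) G).apply_symm_apply _

variable (k G) in
theorem isIrreducible_ofModule' (M : Type*) [AddCommGroup M] [Module k M] [Module k[G] M]
    [IsScalarTower k k[G] M] [IsSimpleModule k[G] M] :
    (Representation.ofModule' (k := k) (G := G) M).IsIrreducible := by
  let ρ := Representation.ofModule' (k := k) (G := G) M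
  let e : ρ.asModule ≃ₗ[k[G]] M :=
    { ρ.asModuleEquiv with
      map_smul' := fun a m => LinearMap.congr_fun
        (DFunLike.congr_fun (asAlgebraHom_ofModule' k G M) a) (ρ.asModuleEquiv m) }
  exact (Representation.irreducible_iff_isSimpleModule_asModule ρ).2 (.congr e)

end IrreducibleRepresentations

section Completeness

theorem eq_zero_of_forall_mem_annihilator_of_isSimpleModule {R : Type*} [Ring R]
    [IsSemisimpleRing R] {z : R}
    (h : ∀ S : Submodule R R, IsSimpleModule R S → z ∈ S.annihilator) : z = 0 := by
  have htop : z ∈ (⊤ : Submodule R R).annihilator := by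
    rw [← IsSemisimpleModule.sSup_simples_eq_top, sSup_eq_iSup', Submodule.annihilator_iSup,
      Submodule.mem_iInf]
    exact fun S => h S S.2
  simpa using Submodule.mem_annihilator.1 htop 1 Submodule.mem_top

theorem isIrrChar_character {G V : Type*} [Group G] [AddCommGroup V] [Module ℂ V]
    [FiniteDimensional ℂ V] {ρ : Representation ℂ G V} (hρ : ρ.IsIrreducible) :
    IsIrrChar ρ.character := by
  let e : V ≃ₗ[ℂ] (Fin (Module.finrank ℂ V) → ℂ) := (Module.finBasis ℂ V).equivFun
  let σ : Representation ℂ G (Fin (Module.finrank ℂ V) → ℂ) :=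
    (e.conjAlgEquiv ℂ : Module.End ℂ V →* _).comp ρ
  let φ : ρ.Equiv σ := .mk e fun g => by ext; simp [σ]
  exact ⟨_, σ, isIrreducible_of_equiv φ hρ, (Representation.char_iso φ).symm⟩

variable {G : Type*} [Group G]

theorem commute_sum_single_inv [Fintype G] {k : Type*} [CommSemiring k] {f : G → k}
    (hf : ∀ x y, f (y * x * y⁻¹) = f x) (a : k[G]) :
    Commute (∑ x, MonoidAlgebra.single x⁻¹ (f x)) a := by
  induction a using MonoidAlgebra.induction_on with
  | of g =>
    simp only [Commute, SemiconjBy, MonoidAlgebra.of_apply, Finset.sum_mul, Finset.mul_sum,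
      MonoidAlgebra.single_mul_single, mul_one, one_mul]
    refine Fintype.sum_equiv (MulAut.conj g⁻¹).toEquiv _ _ fun x => ?_
    have hx : f ((MulAut.conj g⁻¹).toEquiv x) = f x := hf x g⁻¹
    rw [hx]
    congr 1
    simp [mul_assoc]
  | add a b ha hb => exact ha.add_right hb
  | smul c a ha => exact ha.smul_right c

theorem eq_zero_of_forall_isIrrChar_sum_eq_zero [Fintype G] {f : G → ℂ}
    (hf : ∀ x y, f (y * x * y⁻¹) = f x)
    (h : ∀ χ : G → ℂ, IsIrrChar χ → ∑ x, f x * χ x⁻¹ = 0) : f = 0 := by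
  set z : ℂ[G] := ∑ x, MonoidAlgebra.single x⁻¹ (f x) with hz
  have : NeZero (Nat.card G : ℂ) := ⟨Nat.cast_ne_zero.2 Nat.card_pos.ne'⟩
  have hz0 : z = 0 := by
    refine eq_zero_of_forall_mem_annihilator_of_isSimpleModule fun S hS => ?_
    let ρ : Representation ℂ G S := Representation.ofModule' S
    have hρ : ρ.IsIrreducible := isIrreducible_ofModule' ℂ G S
    have : FiniteDimensional ℂ S :=
      inferInstanceAs (FiniteDimensional ℂ (S.restrictScalars ℂ))
    have htrace : LinearMap.trace ℂ S (ρ.asAlgebraHom z) = 0 := by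
      simpa [hz, Representation.character] using h _ (isIrrChar_character hρ)
    have hρz := asAlgebraHom_eq_zero_of_trace_eq_zero hρ (commute_sum_single_inv hf) htrace
    rw [asAlgebraHom_ofModule'] at hρz
    exact Submodule.mem_annihilator.2 fun s hs =>
      congrArg Subtype.val (LinearMap.congr_fun hρz ⟨s, hs⟩)
  ext x
  classical
  have := congrArg (fun b : ℂ[G] => b.coeff x⁻¹) hz0
  simpa [hz, Finsupp.single_apply, Finsupp.finsetSum_apply] using this

end Completeness

section Orthogonality

variable {G : Type*} [Group G]

theorem IsIrrChar.apply_conj {χ : G → ℂ} (hχ : IsIrrChar χ) (x y : G) :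
    χ (y * x * y⁻¹) = χ x := by
  obtain ⟨n, ρ, -, rfl⟩ := hχ
  exact ρ.char_conj x y

theorem IsIrrChar.eq_of_isConj {χ : G → ℂ} (hχ : IsIrrChar χ) {x y : G} (h : IsConj x y) :
    χ x = χ y := by
  obtain ⟨c, rfl⟩ := isConj_iff.1 h
  exact (hχ.apply_conj x c).symm

theorem IsIrrChar.apply_one_ne_zero {χ : G → ℂ} (hχ : IsIrrChar χ) : χ 1 ≠ 0 := by
  obtain ⟨n, ρ, hρ, rfl⟩ := hχ
  have := nontrivial_of_isIrreducible hρ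
  rw [Representation.char_one]
  exact Nat.cast_ne_zero.2 Module.finrank_pos.ne'

theorem natCast_card_ne_zero [Finite G] : (Nat.card G : ℂ) ≠ 0 :=
  Nat.cast_ne_zero.2 Nat.card_pos.ne'

theorem IsIrrChar.sum_mul_inv_self [Fintype G] {χ : G → ℂ} (hχ : IsIrrChar χ) :
    ∑ x, χ x * χ x⁻¹ = Nat.card G := by
  obtain ⟨n, ρ, hρ, rfl⟩ := hχ
  have := invertibleOfNonzero (natCast_card_ne_zero (G := G))
  have h := Representation.char_orthonormal ρ ρ
  rwa [if_pos ⟨Representation.Equiv.refl ρ⟩, inv_mul_eq_one₀ natCast_card_ne_zero, eq_comm] at h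

theorem IsIrrChar.sum_mul_inv_of_ne [Fintype G] {χ ψ : G → ℂ} (hχ : IsIrrChar χ)
    (hψ : IsIrrChar ψ) (hne : χ ≠ ψ) : ∑ x, χ x * ψ x⁻¹ = 0 := by
  obtain ⟨n, ρ, hρ, rfl⟩ := hχ
  obtain ⟨m, σ, hσ, rfl⟩ := hψ
  have := invertibleOfNonzero (natCast_card_ne_zero (G := G))
  have h := Representation.char_orthonormal ρ σ
  rw [if_neg fun ⟨e⟩ => hne (Representation.char_iso e).symm] at h
  exact (mul_eq_zero.1 h).resolve_left (inv_ne_zero natCast_card_ne_zero)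

theorem linearIndependent_isIrrChar [Finite G] :
    LinearIndependent ℂ (fun χ : {χ : G → ℂ | IsIrrChar χ} => (χ : G → ℂ)) := by
  have := Fintype.ofFinite G
  refine linearIndependent_iff'.2 fun s c hc χ hχ => ?_
  have hcoeff : c χ * Nat.card G = 0 := calc
    c χ * Nat.card G = ∑ ψ ∈ s, c ψ * ∑ x, (ψ : G → ℂ) x * (χ : G → ℂ) x⁻¹ := by
      rw [Finset.sum_eq_single_of_mem χ hχ, χ.2.sum_mul_inv_self]
      intro ψ _ hne
      rw [ψ.2.sum_mul_inv_of_ne χ.2 (Subtype.coe_ne_coe.2 hne), mul_zero]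
    _ = ∑ x, (∑ ψ ∈ s, c ψ • (ψ : G → ℂ)) x * (χ : G → ℂ) x⁻¹ := by
      simp only [Finset.sum_apply, Pi.smul_apply, smul_eq_mul, Finset.sum_mul, Finset.mul_sum,
        mul_assoc]
      exact Finset.sum_comm
    _ = 0 := by simp only [hc, Pi.zero_apply, zero_mul, Finset.sum_const_zero]
  exact (mul_eq_zero.1 hcoeff).resolve_right natCast_card_ne_zero

/-- The irreducible complex characters of a finite group, as a `Finset` over which one can sum. -/
noncomputable def irrChars (G : Type*) [Group G] [Finite G] : Finset (G → ℂ) :=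
  (linearIndependent_isIrrChar (G := G)).setFinite.toFinset

@[simp]
theorem mem_irrChars [Finite G] {χ : G → ℂ} : χ ∈ irrChars G ↔ IsIrrChar χ := by
  simp [irrChars]

theorem natCast_card_mul_eq_sum_irrChars [Fintype G] {f : G → ℂ}
    (hf : ∀ x y, f (y * x * y⁻¹) = f x) (y : G) :
    (Nat.card G : ℂ) * f y = ∑ χ ∈ irrChars G, (∑ x, f x * χ x⁻¹) * χ y := by
  refine sub_eq_zero.1 (congrFun (eq_zero_of_forall_isIrrChar_sum_eq_zero (f := fun y =>
    (Nat.card G : ℂ) * f y - ∑ χ ∈ irrChars G, (∑ x, f x * χ x⁻¹) * χ y) ?_ ?_) y)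
  · intro x y
    have hsum : ∑ χ ∈ irrChars G, (∑ x, f x * χ x⁻¹) * χ (y * x * y⁻¹) =
        ∑ χ ∈ irrChars G, (∑ x, f x * χ x⁻¹) * χ x :=
      Finset.sum_congr rfl fun χ hχ => by rw [(mem_irrChars.1 hχ).apply_conj]
    rw [hf, hsum]
  · intro ψ hψ
    have hcoeff : ∑ y, (∑ χ ∈ irrChars G, (∑ x, f x * χ x⁻¹) * χ y) * ψ y⁻¹ =
        (∑ x, f x * ψ x⁻¹) * Nat.card G := calc
      _ = ∑ χ ∈ irrChars G, (∑ x, f x * χ x⁻¹) * ∑ y, χ y * ψ y⁻¹ := by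
        simp only [Finset.sum_mul _ _ (ψ _), Finset.mul_sum _ _ (∑ x, f x * _), mul_assoc]
        exact Finset.sum_comm
      _ = _ := by
        rw [Finset.sum_eq_single_of_mem ψ (mem_irrChars.2 hψ), hψ.sum_mul_inv_self]
        intro χ hχ hne
        rw [(mem_irrChars.1 hχ).sum_mul_inv_of_ne hψ hne, mul_zero]
    simp only [sub_mul, Finset.sum_sub_distrib, hcoeff, mul_assoc, ← Finset.mul_sum]
    ring

theorem isConj_conj_right_iff {x y c : G} : IsConj x (c * y * c⁻¹) ↔ IsConj x y :=
  ⟨fun h => h.trans (isConj_iff.2 ⟨c, rfl⟩).symm, fun h => h.trans (isConj_iff.2 ⟨c, rfl⟩)⟩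

theorem ncard_conjugatesOf_mul_card_centralizer (g : G) :
    (conjugatesOf g).ncard * Nat.card (Subgroup.centralizer {g}) = Nat.card G := by
  have horbit : MulAction.orbit (ConjAct G) g = conjugatesOf g := by
    ext x
    exact ConjAct.mem_orbit_conjAct.trans isConj_comm
  rw [Subgroup.nat_card_centralizer_nat_card_stabilizer, ← horbit, ← Nat.card_coe_set_eq,
    ← Nat.card_prod, Nat.card_congr (MulAction.orbitProdStabilizerEquivGroup (ConjAct G) g)]
  exact Nat.card_congr (ConjAct.toConjAct (G := G)).symm.toEquiv

open Classical in
theorem IsIrrChar.sum_mul_inv_conjugatesOf [Fintype G] {χ : G → ℂ} (hχ : IsIrrChar χ) (y : G) :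
    ∑ x, (if IsConj y x then 1 else 0) * χ x⁻¹ = (conjugatesOf y).ncard * χ y⁻¹ := by
  have hterm : ∀ x, (if IsConj y x then 1 else 0) * χ x⁻¹ = if IsConj y x then χ y⁻¹ else 0 := by
    intro x
    split_ifs with hx
    · obtain ⟨c, rfl⟩ := isConj_iff.1 hx
      simpa only [one_mul, conj_inv] using hχ.apply_conj y⁻¹ c
    · exact zero_mul _
  have hcard : (conjugatesOf y).ncard = (Finset.univ.filter (IsConj y)).card := by
    rw [← Set.ncard_coe_finset, Finset.coe_filter_univ]
    rfl
  rw [Finset.sum_congr rfl fun x _ => hterm x, ← Finset.sum_filter, Finset.sum_const, nsmul_eq_mul,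
    hcard]

open Classical in
theorem sum_irrChars_mul_inv [Finite G] (x y : G) :
    ∑ χ ∈ irrChars G, χ x * χ y⁻¹ =
      if IsConj y x then (Nat.card (Subgroup.centralizer {y}) : ℂ) else 0 := by
  have := Fintype.ofFinite G
  have hexpand := natCast_card_mul_eq_sum_irrChars (f := fun z => if IsConj y z then 1 else 0)
    (fun x y => by simp only [isConj_conj_right_iff]) x
  rw [Finset.sum_congr rfl fun χ hχ => by
      rw [(mem_irrChars.1 hχ).sum_mul_inv_conjugatesOf, mul_right_comm, mul_assoc],
    ← Finset.mul_sum, ← ncard_conjugatesOf_mul_card_centralizer y, Nat.cast_mul,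
    mul_assoc] at hexpand
  have hncard : ((conjugatesOf y).ncard : ℂ) ≠ 0 :=
    Nat.cast_ne_zero.2 (Set.ncard_ne_zero_of_mem mem_conjugatesOf_self)
  rw [← mul_left_cancel₀ hncard hexpand]
  split_ifs <;> simp

end Orthogonality

section LinearCharacters

theorem isIrrChar_coe {G : Type*} [Group G] (φ : G →* ℂˣ) : IsIrrChar fun g => (φ g : ℂ) := by
  let ρ : Representation ℂ G ℂ := (Algebra.lmul ℂ ℂ : ℂ →* _).comp ((Units.coeHom ℂ).comp φ)
  have hχ : ρ.character = fun g => (φ g : ℂ) :=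
    funext fun g => Algebra.trace_self_apply (R := ℂ) (φ g : ℂ)
  exact hχ ▸ isIrrChar_character (isIrreducible_of_finrank_eq_one (ρ := ρ) (Module.finrank_self ℂ))

theorem IsIrrChar.exists_hom_of_apply_one_eq_one {G : Type*} [Group G] {χ : G → ℂ}
    (hχ : IsIrrChar χ) (h1 : χ 1 = 1) : ∃ φ : G →* ℂˣ, χ = fun g => (φ g : ℂ) := by
  obtain ⟨n, ρ, -, rfl⟩ := hχ
  have hdim : Module.finrank ℂ (Fin n → ℂ) = 1 := by
    rw [Representation.char_one] at h1
    exact_mod_cast h1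
  have hscalar : ∀ g, ρ g = ρ.character g • LinearMap.id := by
    intro g
    obtain ⟨c, hc, -⟩ := LinearMap.existsUnique_eq_smul_id_of_finrank_eq_one hdim (ρ g)
    rw [Representation.character, hc, map_smul, LinearMap.trace_id, hdim, Nat.cast_one,
      smul_eq_mul, mul_one]
  let φ : G →* ℂ :=
    { toFun := ρ.character
      map_one' := h1
      map_mul' := fun x y => by
        rw [Representation.character, map_mul, hscalar x, smul_mul_assoc, map_smul]
        exact congrArg _ (congrArg (LinearMap.trace ℂ _) (one_mul (ρ y))) }
  exact ⟨φ.toHomUnits, rfl⟩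

open Classical in
theorem sum_hom_units_apply {A : Type*} [CommGroup A] [Finite A] [Fintype (A →* ℂˣ)] (a : A) :
    ∑ φ : A →* ℂˣ, (φ a : ℂ) = if a = 1 then (Nat.card A : ℂ) else 0 := by
  let ev : (A →* ℂˣ) →* ℂ := (Units.coeHom ℂ).comp (MonoidHom.eval a)
  have hev : ev = 1 ↔ a = 1 := by
    refine ⟨fun h => ?_, ?_⟩
    · by_contra ha
      obtain ⟨φ, hφ⟩ := CommGroup.exists_apply_ne_one_of_hasEnoughRootsOfUnity A ℂ ha
      exact hφ (Units.ext (DFunLike.congr_fun h φ))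
    · rintro rfl
      ext φ
      simp [ev]
  have hcard : Fintype.card (A →* ℂˣ) = Nat.card A := by
    rw [← Nat.card_eq_fintype_card]
    exact CommGroup.card_monoidHom_of_hasEnoughRootsOfUnity A ℂ
  have hsum : ∑ φ : A →* ℂˣ, (φ a : ℂ) = _ := sum_hom_units ev
  rw [hsum, hcard]
  simp only [hev, Nat.cast_ite, Nat.cast_zero]

variable {G : Type*} [Group G] [Finite G]

open Classical in
theorem sum_linear_irrChars_mul_inv (x y : G) :
    ∑ χ ∈ irrChars G with χ 1 = 1, χ x * χ y⁻¹ =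
      if x * y⁻¹ ∈ commutator G then ((commutator G).index : ℂ) else 0 := by
  have hfin : Finite (Abelianization G) := inferInstanceAs (Finite (G ⧸ commutator G))
  have := Fintype.ofFinite (Abelianization G →* ℂˣ)
  calc
    _ = ∑ φ : Abelianization G →* ℂˣ, (φ (Abelianization.of (x * y⁻¹)) : ℂ) := by
      symm
      refine Finset.sum_bij (fun φ _ g => (φ (Abelianization.of g) : ℂ)) ?_ ?_ ?_ ?_
      · intro φ _
        rw [Finset.mem_filter, mem_irrChars]
        exact ⟨isIrrChar_coe (φ.comp Abelianization.of), by simp⟩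
      · intro φ _ ψ _ h
        exact Abelianization.hom_ext _ _ (MonoidHom.ext fun g => Units.ext (congrFun h g))
      · intro χ hχ
        rw [Finset.mem_filter, mem_irrChars] at hχ
        obtain ⟨φ, rfl⟩ := hχ.1.exists_hom_of_apply_one_eq_one hχ.2
        exact ⟨Abelianization.lift φ, Finset.mem_univ _, by simp⟩
      · intro φ _
        simp
    _ = _ := by
      rw [sum_hom_units_apply, ← MonoidHom.mem_ker, Abelianization.ker_of]
      rfl

/-- The nonlinear irreducible characters of a finite group, as a `Finset`. -/
noncomputable def nonlinearIrrChars (G : Type*) [Group G] [Finite G] : Finset (G → ℂ) :=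
  open Classical in {χ ∈ irrChars G | χ 1 ≠ 1}

@[simp]
theorem mem_nonlinearIrrChars {χ : G → ℂ} : χ ∈ nonlinearIrrChars G ↔ IsNonlinearIrrChar χ := by
  rw [nonlinearIrrChars, Finset.mem_filter, mem_irrChars, IsNonlinearIrrChar]

open Classical in
theorem index_commutator_add_sum_nonlinearIrrChars (x y : G) :
    (if x * y⁻¹ ∈ commutator G then ((commutator G).index : ℂ) else 0) +
      ∑ χ ∈ nonlinearIrrChars G, χ x * χ y⁻¹ =
      if IsConj y x then (Nat.card (Subgroup.centralizer {y}) : ℂ) else 0 := by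
  rw [← sum_linear_irrChars_mul_inv, ← sum_irrChars_mul_inv]
  exact Finset.sum_filter_add_sum_filter_not _ _ _

end LinearCharacters

section IsolatedCharacters

/-- `χ` is isolated at `g` if it is the only nonlinear irreducible character that does not vanish
at `g`; this is the condition on `χ` and `g` in `IsolatedCharWithKernel`. -/
def IsIsolatedAt {G : Type*} [Group G] (χ : G → ℂ) (g : G) : Prop :=
  IsNonlinearIrrChar χ ∧ χ g ≠ 0 ∧ ∀ ψ : G → ℂ, IsNonlinearIrrChar ψ → ψ ≠ χ → ψ g = 0

namespace IsIsolatedAt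

variable {G : Type*} [Group G] [Finite G] {χ : G → ℂ} {g : G}

open Classical in
theorem index_commutator_add_mul_inv (h : IsIsolatedAt χ g) (y : G) :
    (if g * y⁻¹ ∈ commutator G then ((commutator G).index : ℂ) else 0) + χ g * χ y⁻¹ =
      if IsConj y g then (Nat.card (Subgroup.centralizer {y}) : ℂ) else 0 := by
  rw [← index_commutator_add_sum_nonlinearIrrChars,
    Finset.sum_eq_single_of_mem χ (mem_nonlinearIrrChars.2 h.1)]
  intro ψ hψ hne
  rw [h.2.2 ψ (mem_nonlinearIrrChars.1 hψ) hne, zero_mul]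

theorem mem_commutator (h : IsIsolatedAt χ g) (hg : g ≠ 1) : g ∈ commutator G := by
  by_contra hgc
  have hcol := h.index_commutator_add_mul_inv 1
  rw [inv_one, mul_one, if_neg hgc, if_neg (isConj_one_right.not.2 hg), zero_add] at hcol
  exact mul_ne_zero h.2.1 h.1.1.apply_one_ne_zero hcol

theorem apply_inv_eq_apply_one_iff (h : IsIsolatedAt χ g) (hg : g ≠ 1) {x : G} :
    χ x⁻¹ = χ 1 ↔ x ∈ commutator G ∧ ¬ IsConj g x := by
  have hgc := h.mem_commutator hg
  have hone := h.index_commutator_add_mul_inv 1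
  rw [inv_one, mul_one, if_pos hgc, if_neg (isConj_one_right.not.2 hg)] at hone
  have hcol := h.index_commutator_add_mul_inv x
  rw [Subgroup.mul_mem_cancel_left _ hgc, inv_mem_iff, isConj_comm] at hcol
  by_cases hxc : x ∈ commutator G
  · rw [if_pos hxc] at hcol
    simp only [hxc, true_and]
    constructor
    · intro hx hconj
      rw [hx, hone, if_pos hconj] at hcol
      exact Nat.cast_ne_zero.2 Nat.card_pos.ne' hcol.symm
    · intro hconj
      rw [if_neg hconj, ← hone] at hcol
      exact mul_left_cancel₀ h.2.1 (add_left_cancel hcol)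
  · have hconj : ¬ IsConj g x := fun hgx => by
      obtain ⟨c, rfl⟩ := isConj_iff.1 hgx
      exact hxc (Subgroup.Normal.conj_mem inferInstance g hgc c)
    rw [if_neg hxc, if_neg hconj, zero_add] at hcol
    have hx : χ x⁻¹ = 0 := (mul_eq_zero.1 hcol).resolve_left h.2.1
    simp only [hx, hxc, false_and, iff_false]
    exact h.1.1.apply_one_ne_zero.symm

theorem forall_mem_iff (h : IsIsolatedAt χ g) (hg : g ≠ 1) {K : Subgroup G} :
    (∀ x, x ∈ K ↔ χ x = χ 1) ↔
      K ≤ commutator G ∧ conjugatesOf g = (commutator G : Set G) \ K := by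
  have hconj : conjugatesOf g ⊆ (commutator G : Set G) :=
    Group.conjugates_subset_normal (h.mem_commutator hg)
  have hinv : (∀ x, x ∈ K ↔ χ x = χ 1) ↔ (K : Set G) = (commutator G : Set G) \ conjugatesOf g := by
    rw [← (Equiv.inv G).forall_congr_right, Set.ext_iff]
    refine forall_congr' fun x => ?_
    simp only [Equiv.inv_apply, inv_mem_iff, h.apply_inv_eq_apply_one_iff hg]
    rfl
  rw [hinv, ← SetLike.coe_subset_coe]
  constructor
  · intro hK
    rw [hK, sdiff_sdiff_right_self]
    exact ⟨Set.sdiff_subset, (Set.inter_eq_right.2 hconj).symm⟩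
  · rintro ⟨hK, hg⟩
    rw [hg, sdiff_sdiff_right_self]
    exact (Set.inter_eq_right.2 hK).symm

end IsIsolatedAt

theorem IsolatedCharWithKernel.exists_conjugatesOf_eq {G : Type*} [Group G] [Finite G]
    {K : Subgroup G} (h : IsolatedCharWithKernel G K) :
    K ≤ commutator G ∧ ∃ g, conjugatesOf g = (commutator G : Set G) \ K := by
  obtain ⟨g, χ, hgcenter, hχ, hχg, hiso, hK⟩ := h
  have hg : g ≠ 1 := fun h => hgcenter (h ▸ one_mem _)
  have hisolated : IsIsolatedAt χ g := ⟨hχ, hχg, hiso⟩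
  exact ((hisolated.forall_mem_iff hg).1 hK).imp_right fun h => ⟨g, h⟩

end IsolatedCharacters

section IntegralValues

theorem isIntegral_character {k G V : Type*} [Field k] [IsAlgClosed k] [Group G] [Finite G]
    [AddCommGroup V] [Module k V] [FiniteDimensional k V] (ρ : Representation k G V) (g : G) :
    IsIntegral ℤ (ρ.character g) := by
  rw [Representation.character,
    Module.End.trace_eq_sum_roots_charpoly_of_splits (IsAlgClosed.splits _)]
  refine IsIntegral.multiset_sum fun μ hμ => ?_
  have hμ' : Module.End.HasEigenvalue (ρ g) μ :=
    (Module.End.hasEigenvalue_iff_isRoot_charpoly _ _).2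
      (Polynomial.isRoot_of_mem_roots hμ)
  obtain ⟨v, hv⟩ := hμ'.exists_hasEigenvector
  have hpow : μ ^ Nat.card G • v = (1 : k) • v := by
    rw [← hv.pow_apply, ← map_pow, pow_card_eq_one', map_one, one_smul, Module.End.one_apply]
  exact IsIntegral.of_pow Nat.card_pos (smul_left_injective k hv.2 hpow ▸ isIntegral_one)

theorem exists_int_eq_of_isIntegral_of_mul_eq {k : Type*} [Field k] [CharZero k] {c : k}
    (hc : IsIntegral ℤ c) {m n : ℤ} (hm : m ≠ 0) (h : m * c = n) : ∃ a : ℤ, c = a := by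
  have hc' : c = algebraMap ℚ k (n / m) := by
    rw [map_div₀, map_intCast, map_intCast, eq_div_iff (Int.cast_ne_zero.2 hm), mul_comm, h]
  rw [hc', isIntegral_algebraMap_iff (algebraMap ℚ k).injective] at hc
  obtain ⟨a, ha⟩ := IsIntegrallyClosed.isIntegral_iff.1 hc
  exact ⟨a, by rw [hc', ← ha]; simp⟩

theorem exists_int_eq_of_forall_character_eq {k G V : Type*} [Field k] [IsAlgClosed k] [CharZero k]
    [Group G] [Finite G] [Nontrivial G] [AddCommGroup V] [Module k V] [FiniteDimensional k V]
    (ρ : Representation k G V) {c : k} (h : ∀ g ≠ 1, ρ.character g = c) : ∃ a : ℤ, c = a := by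
  classical
  have := Fintype.ofFinite G
  have hG : (Nat.card G : k) ≠ 0 := Nat.cast_ne_zero.2 Nat.card_pos.ne'
  have := invertibleOfNonzero hG
  have hmean : ∑ g, ρ.character g = Nat.card G * Module.finrank k ρ.invariants := by
    rw [← ρ.card_inv_mul_sum_char_eq_finrank, mul_inv_cancel_left₀ hG]
  have hsum : ∑ g, ρ.character g = Module.finrank k V + (Nat.card G - 1) * c := by
    rw [← Finset.add_sum_erase _ _ (Finset.mem_univ 1), Representation.char_one,
      Finset.sum_congr rfl fun g hg => h g (Finset.ne_of_mem_erase hg), Finset.sum_const,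
      Finset.card_erase_of_mem (Finset.mem_univ 1), Finset.card_univ, ← Nat.card_eq_fintype_card,
      nsmul_eq_mul, Nat.cast_pred Nat.card_pos]
  obtain ⟨g, hg⟩ := exists_ne (1 : G)
  refine exists_int_eq_of_isIntegral_of_mul_eq (h g hg ▸ isIntegral_character ρ g)
    (m := Nat.card G - 1) (n := Nat.card G * Module.finrank k ρ.invariants - Module.finrank k V)
    ?_ ?_
  · have := Finite.one_lt_card (α := G)
    omega
  · push_cast
    linear_combination hmean - hsum

theorem IsIrrChar.exists_int_eq {G : Type*} [Group G] [Finite G] {χ : G → ℂ} (hχ : IsIrrChar χ)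
    {H : Subgroup G} (hH : H ≠ ⊥) {g : G} (hconj : ∀ x ∈ H, x ≠ 1 → IsConj g x) :
    ∃ a : ℤ, χ g = a := by
  have := H.nontrivial_iff_ne_bot.2 hH
  have hconst : ∀ x : H, x ≠ 1 → χ x = χ g := fun x hx =>
    (hχ.eq_of_isConj (hconj x x.2 (by simpa using hx))).symm
  obtain ⟨n, ρ, -, rfl⟩ := hχ
  exact exists_int_eq_of_forall_character_eq (ρ.comp H.subtype) hconst

end IntegralValues

section ExistenceOfIsolatedCharacters

variable {G : Type*} [Group G] [Finite G] {g : G}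

theorem exists_isNonlinearIrrChar_apply_ne_zero (hg : g ≠ 1) (hgc : g ∈ commutator G) :
    ∃ χ : G → ℂ, IsNonlinearIrrChar χ ∧ χ g ≠ 0 := by
  classical
  by_contra! hzero
  have hcol := index_commutator_add_sum_nonlinearIrrChars g 1
  rw [Finset.sum_eq_zero fun χ hχ => by rw [hzero χ (mem_nonlinearIrrChars.1 hχ), zero_mul],
    inv_one, mul_one, if_pos hgc, if_neg (isConj_one_right.not.2 hg), add_zero] at hcol
  exact Nat.cast_ne_zero.2 Subgroup.index_ne_zero_of_finite hcol

theorem isIsolatedAt_of_card_centralizer_le (hinv : IsConj g g⁻¹)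
    (hint : ∀ ψ : G → ℂ, IsNonlinearIrrChar ψ → ∃ a : ℤ, ψ g = a)
    (hcard : Nat.card (Subgroup.centralizer {g}) ≤ (commutator G).index + 1)
    {χ : G → ℂ} (hχ : IsNonlinearIrrChar χ) (hχg : χ g ≠ 0) : IsIsolatedAt χ g := by
  classical
  choose! a ha using hint
  have hsum : ((commutator G).index : ℤ) + ∑ ψ ∈ nonlinearIrrChars G, a ψ ^ 2 =
      Nat.card (Subgroup.centralizer {g}) := by
    have hcol := index_commutator_add_sum_nonlinearIrrChars g g
    rw [mul_inv_cancel, if_pos (one_mem _), if_pos (IsConj.refl g)] at hcol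
    rw [← Int.cast_inj (α := ℂ), Int.cast_natCast, ← hcol, Int.cast_add, Int.cast_sum,
      Int.cast_natCast]
    congr 1
    refine Finset.sum_congr rfl fun ψ hψ => ?_
    rw [mem_nonlinearIrrChars] at hψ
    rw [← hψ.1.eq_of_isConj hinv, ha ψ hψ, Int.cast_pow, sq]
  have hpos : ∀ ψ, IsNonlinearIrrChar ψ → ψ g ≠ 0 → 0 < a ψ ^ 2 := fun ψ hψ hψg =>
    sq_pos_of_ne_zero fun h => hψg (by rw [ha ψ hψ, h, Int.cast_zero])
  refine ⟨hχ, hχg, fun ψ hψ hne => ?_⟩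
  by_contra hψg
  have hpair : a χ ^ 2 + a ψ ^ 2 ≤ ∑ φ ∈ nonlinearIrrChars G, a φ ^ 2 := by
    rw [← Finset.sum_pair (f := fun φ => a φ ^ 2) hne.symm]
    refine Finset.sum_le_sum_of_subset_of_nonneg ?_ fun _ _ _ => sq_nonneg _
    simp [Finset.insert_subset_iff, hχ, hψ]
  have := hpos χ hχ hχg
  have := hpos ψ hψ hψg
  omega

theorem exists_isIsolatedAt (hg : g ≠ 1) (hgc : g ∈ commutator G) {H : Subgroup G} (hgH : g ∈ H)
    (hconj : ∀ x ∈ H, x ≠ 1 → IsConj g x)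
    (hcard : Nat.card (Subgroup.centralizer {g}) ≤ (commutator G).index + 1) :
    ∃ χ : G → ℂ, IsIsolatedAt χ g := by
  have hH : H ≠ ⊥ := fun h => hg (by simpa [h] using hgH)
  obtain ⟨χ, hχ, hχg⟩ := exists_isNonlinearIrrChar_apply_ne_zero hg hgc
  exact ⟨χ, isIsolatedAt_of_card_centralizer_le (hconj _ (inv_mem hgH) (inv_ne_one.2 hg))
    (fun ψ hψ => hψ.1.exists_int_eq hH hconj) hcard hχ hχg⟩

end ExistenceOfIsolatedCharacters

section FrobeniusActions

/-- A Frobenius (fixed-point-free) action of `H` on `K`: only the identity of `K` is fixed by a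
nontrivial element of `H`. -/
def IsFrobeniusAction (H K : Type*) [Group H] [Group K] [MulDistribMulAction H K] : Prop :=
  ∀ h : H, h ≠ 1 → MonoidHom.FixedPointFree (fun k : K => h • k)

theorem prod_pow_smul_eq_one {H A : Type*} [Group H] [CommGroup A] [MulDistribMulAction H A]
    {n : ℕ} {h : H} (hn : h ^ n = 1) (hfix : MonoidHom.FixedPointFree (fun a : A => h • a))
    (a : A) : ∏ i ∈ Finset.range n, h ^ i • a = 1 := by
  refine hfix _ ?_
  have hshift := Finset.prod_range_succ (fun i => h ^ i • a) n
  rw [Finset.prod_range_succ', pow_zero, hn] at hshift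
  simp only [Finset.smul_prod', smul_smul, ← pow_succ']
  exact mul_right_cancel hshift

namespace IsFrobeniusAction

/-- Evaluate `∏ i, ∏ j, (h * k ^ j) ^ i • a` in both orders: the product over `i` is trivial for
each `j`, and the product over `j` is trivial for each `i ≠ 0`, so that only `i = 0` is left, which
contributes `a ^ p`. -/
theorem pow_eq_one_of_notMem_zpowers {H A : Type*} [Group H] [CommGroup A]
    [MulDistribMulAction H A] (hact : IsFrobeniusAction H A) {p : ℕ} (hp : p.Prime)
    (hH : IsElementaryAbelian p H) {h k : H} (hk : k ≠ 1) (hh : h ∉ Subgroup.zpowers k) (a : A) :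
    a ^ p = 1 := by
  have hone : ∏ j ∈ Finset.range p, ∏ i ∈ Finset.range p, (h * k ^ j) ^ i • a = 1 := by
    refine Finset.prod_eq_one fun j _ => prod_pow_smul_eq_one (hH.2 _) (hact _ fun h0 => hh ?_) a
    rw [eq_inv_of_mul_eq_one_left h0]
    exact inv_mem (pow_mem (Subgroup.mem_zpowers k) j)
  have hinner : ∀ i ∈ Finset.range p, i ≠ 0 → ∏ j ∈ Finset.range p, (h * k ^ j) ^ i • a = 1 := by
    intro i hi hi0
    have hki : k ^ i ≠ 1 := pow_ne_one_of_lt_orderOf hi0 <| by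
      rwa [@orderOf_eq_prime _ _ _ _ ⟨hp⟩ (hH.2 k) hk, ← Finset.mem_range]
    have hsmul : ∀ j, (h * k ^ j) ^ i • a = h ^ i • (k ^ i) ^ j • a := fun j => by
      rw [(show Commute h (k ^ j) from hH.1 _ _).mul_pow, smul_smul, ← pow_mul, ← pow_mul, mul_comm]
    simp only [hsmul]
    rw [← Finset.smul_prod', prod_pow_smul_eq_one (hH.2 _) (hact _ hki), smul_one]
  rw [Finset.prod_comm,
    Finset.prod_eq_single_of_mem 0 (Finset.mem_range.2 hp.pos) hinner] at hone
  simpa using hone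

variable {H K : Type*} [Group H] [Group K] [MulDistribMulAction H K]

open scoped IsMulCommutative in
theorem pow_eq_one_of_mem (hact : IsFrobeniusAction H K) {p : ℕ} (hp : p.Prime)
    (hH : IsElementaryAbelian p H) {h k : H} (hk : k ≠ 1) (hh : h ∉ Subgroup.zpowers k)
    {A : Subgroup K} [IsMulCommutative A] (hA : ∀ (x : H), ∀ a ∈ A, x • a ∈ A) {a : K}
    (ha : a ∈ A) : a ^ p = 1 := by
  let _ : SMul H A := ⟨fun x a => ⟨x • (a : K), hA x a a.2⟩⟩
  let _ : MulDistribMulAction H A :=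
    Function.Injective.mulDistribMulAction A.subtype A.subtype_injective fun _ _ => rfl
  have hactA : IsFrobeniusAction H A := fun x hx a ha =>
    Subtype.ext (hact x hx a (congrArg Subtype.val ha))
  exact congrArg Subtype.val (hactA.pow_eq_one_of_notMem_zpowers hp hH hk hh ⟨a, ha⟩)

theorem not_dvd_card [Nontrivial H] [Finite K] (hact : IsFrobeniusAction H K) {p : ℕ}
    [Fact p.Prime] (hH : IsPGroup p H) : ¬ p ∣ Nat.card K := by
  obtain ⟨h, hh⟩ := exists_ne (1 : H)
  have hfixed : MulAction.fixedPoints H K = {1} :=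
    Set.eq_singleton_iff_unique_mem.2 ⟨fun x => smul_one x, fun k hk => hact h hh k (hk h)⟩
  have hmod := hH.card_modEq_card_fixedPoints K
  rw [hfixed, Nat.card_coe_set_eq, Set.ncard_singleton] at hmod
  rw [hmod.dvd_iff dvd_rfl]
  exact (Fact.out : p.Prime).not_dvd_one

end IsFrobeniusAction

theorem smul_mem_inf_centralizer {H K : Type*} [Group H] [Group K] [MulDistribMulAction H K]
    {Q : Subgroup K} (hQ : ∀ (x : H), ∀ a ∈ Q, x • a ∈ Q) (x : H) {a : K}
    (ha : a ∈ Q ⊓ Subgroup.centralizer Q) : x • a ∈ Q ⊓ Subgroup.centralizer Q := by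
  refine ⟨hQ x a ha.1, Subgroup.mem_centralizer_iff.2 fun b hb => ?_⟩
  rw [← smul_inv_smul x b, ← smul_mul', ← smul_mul',
    Subgroup.mem_centralizer_iff.1 ha.2 _ (hQ x⁻¹ b hb)]

theorem exists_stable_isMulCommutative_subgroup {H K : Type*} [Group H] [Finite H] [Group K]
    [Finite K] [Nontrivial K] [MulDistribMulAction H K] {p : ℕ} [Fact p.Prime] (hH : IsPGroup p H)
    (hK : ¬ p ∣ Nat.card K) :
    ∃ A : Subgroup K, A ≠ ⊥ ∧ IsMulCommutative A ∧ ∀ (x : H), ∀ a ∈ A, x • a ∈ A := by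
  obtain ⟨q, hq, hqK⟩ := Nat.exists_prime_and_dvd (Finite.one_lt_card (α := K)).ne'
  have : Fact q.Prime := ⟨hq⟩
  obtain ⟨Q, hQ⟩ := hH.nonempty_fixed_point_of_prime_not_dvd_card (Sylow q K) fun hdvd =>
    hK (hdvd.trans ((default : Sylow q K).card_dvd_index.trans (Subgroup.index_dvd_card _)))
  have hQmem : ∀ (x : H), ∀ a ∈ (Q : Subgroup K), x • a ∈ (Q : Subgroup K) := fun x a ha => by
    have := Subgroup.smul_mem_pointwise_smul a x (Q : Subgroup K) ha
    rwa [← Sylow.pointwise_smul_def, hQ x] at this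
  refine ⟨Q ⊓ Subgroup.centralizer Q, ?_, ⟨⟨?_⟩⟩,
    fun x a ha => smul_mem_inf_centralizer hQmem x ha⟩
  · have : Nontrivial Q := (Subgroup.nontrivial_iff_ne_bot _).2 (Q.ne_bot_of_dvd_card hqK)
    have := Q.isPGroup'.center_nontrivial
    obtain ⟨z, hz⟩ := exists_ne (1 : Subgroup.center Q)
    have hz_centralizer : (z : K) ∈ Subgroup.centralizer Q := Subgroup.mem_centralizer_iff.2
      fun b hb => congrArg Subtype.val (Subgroup.mem_center_iff.1 z.2 ⟨b, hb⟩)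
    refine Subgroup.ne_bot_iff_exists_ne_one.2 ⟨⟨z, z.1.2, hz_centralizer⟩, fun h => ?_⟩
    exact hz (Subtype.ext (Subtype.ext (show ((z : Q) : K) = 1 from Subtype.ext_iff.1 h)))
  · exact fun a b => Subtype.ext (Subgroup.mem_centralizer_iff.1 b.2.2 a a.2.1)

theorem IsElementaryAbelian.isPGroup {p : ℕ} {E : Type*} [Group E] (hE : IsElementaryAbelian p E) :
    IsPGroup p E :=
  fun x => ⟨1, by rw [pow_one, hE.2]⟩

theorem IsElementaryAbelian.card_eq {p : ℕ} (hp : p.Prime) {E : Type*} [Group E] [Finite E]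
    [Nontrivial E] [IsCyclic E] (hE : IsElementaryAbelian p E) : Nat.card E = p := by
  have hdvd : Nat.card E ∣ p := by
    rw [← IsCyclic.exponent_eq_card]
    exact Monoid.exponent_dvd_of_forall_pow_eq_one hE.2
  exact (hp.eq_one_or_self_of_dvd _ hdvd).resolve_left (Finite.one_lt_card (α := E)).ne'

theorem IsFrobeniusAction.isCyclic {H K : Type*} [Group H] [Finite H] [Group K] [Finite K]
    [Nontrivial K] [MulDistribMulAction H K] (hact : IsFrobeniusAction H K) {p : ℕ} (hp : p.Prime)
    (hH : IsElementaryAbelian p H) : IsCyclic H := by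
  nontriviality H
  have : Fact p.Prime := ⟨hp⟩
  have hpK : ¬ p ∣ Nat.card K := hact.not_dvd_card hH.isPGroup
  obtain ⟨k, hk⟩ := exists_ne (1 : H)
  refine ⟨k, fun h => ?_⟩
  by_contra hh
  obtain ⟨A, hA, _, hstable⟩ := exists_stable_isMulCommutative_subgroup hH.isPGroup hpK
  obtain ⟨a, haA, ha⟩ := A.bot_or_exists_ne_one.resolve_left hA
  have hap : orderOf a = p := orderOf_eq_prime (hact.pow_eq_one_of_mem hp hH hk hh hstable haA) ha
  exact hpK (hap ▸ orderOf_dvd_natCard a)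

end FrobeniusActions

section FrobeniusGroups

theorem IsElementaryAbelian.of_injective {p : ℕ} {D E : Type*} [Group D] [Group E]
    (hE : IsElementaryAbelian p E) {f : D →* E} (hf : Function.Injective f) :
    IsElementaryAbelian p D :=
  ⟨fun a b => hf (by rw [map_mul, map_mul, hE.1]), fun a => hf (by rw [map_pow, hE.2, map_one])⟩

theorem isFrobeniusWithKernel_of_coprime {G : Type*} [Group G] {N : Subgroup G} [N.Normal]
    (hbot : N ≠ ⊥) (htop : N ≠ ⊤) (hcoprime : (Nat.card N).Coprime N.index)
    (hfix : ∀ x ∉ N, ∀ n ∈ N, Commute x n → n = 1) : IsFrobeniusWithKernel N := by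
  obtain ⟨H, hH⟩ := Subgroup.exists_right_complement'_of_coprime hcoprime
  refine ⟨inferInstance, hbot, H, ?_, hH, fun h hh h1 => hfix h fun hN => h1 ?_⟩
  · rintro rfl
    exact htop (Subgroup.isComplement'_bot_right.1 hH)
  · exact Subgroup.disjoint_def.1 hH.disjoint hN hh

variable {G : Type*} [Group G] [Finite G] {N : Subgroup G}

theorem exists_conj_eq_of_isComplement' [N.Normal] {H : Subgroup G} (hNH : N.IsComplement' H)
    (hfix : ∀ h ∈ H, h ≠ 1 → ∀ n ∈ N, Commute h n → n = 1) {x : G} (hx : x ∉ N) :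
    ∃ h ∈ H, h ≠ 1 ∧ ∃ n : G, n * h * n⁻¹ = x := by
  obtain ⟨⟨a, h⟩, rfl⟩ := hNH.2 x
  have hh : (h : G) ≠ 1 := fun h1 => hx (by simp [h1])
  let φ : MulAut N := MulAut.conjNormal (h : G)
  have hφ : MonoidHom.FixedPointFree φ := fun n hn => Subtype.ext <| by
    refine hfix h h.2 hh n n.2 (mul_inv_eq_iff_eq_mul.1 ?_)
    rw [← MulAut.conjNormal_apply, hn]
  obtain ⟨n, rfl⟩ := hφ.commutatorMap_surjective a
  refine ⟨h, h.2, hh, n, ?_⟩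
  simp [φ, MulAut.conjNormal_apply, div_eq_mul_inv, mul_assoc]

theorem IsFrobeniusWithKernel.eq_one_of_commute (hN : IsFrobeniusWithKernel N) {x n : G}
    (hx : x ∉ N) (hn : n ∈ N) (hcomm : Commute x n) : n = 1 := by
  obtain ⟨hnormal, -, H, -, hNH, hfix⟩ := hN
  obtain ⟨h, hh, h1, y, rfl⟩ := exists_conj_eq_of_isComplement' hNH hfix hx
  have hconj : Commute h (y⁻¹ * n * y) := by
    simpa [MulAut.conj_apply, mul_assoc] using hcomm.map (MulAut.conj y⁻¹)
  have hone := hfix h hh h1 _ (by simpa using hnormal.conj_mem n hn y⁻¹) hconj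
  simpa [mul_assoc] using congrArg (fun z => y * z * y⁻¹) hone

theorem IsFrobeniusWithKernel.index_ker_eq {p : ℕ} (hp : p.Prime) {E : Type*} [Group E]
    {f : G →* E} (hf : IsFrobeniusWithKernel f.ker) (hE : IsElementaryAbelian p E) :
    f.ker.index = p := by
  obtain ⟨-, hbot, H, hHbot, hH, hfix⟩ := hf
  have : Nontrivial H := H.nontrivial_iff_ne_bot.2 hHbot
  have : Nontrivial f.ker := f.ker.nontrivial_iff_ne_bot.2 hbot
  have hinj : Function.Injective (f.comp H.subtype) :=
    (injective_iff_map_eq_one _).2 fun h hh =>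
      Subtype.ext (Subgroup.disjoint_def.1 hH.disjoint (MonoidHom.mem_ker.2 hh) h.2)
  have hHE : IsElementaryAbelian p H := hE.of_injective hinj
  let _ : MulDistribMulAction G f.ker := .compHom f.ker (MulAut.conjNormal (H := f.ker))
  have hact : IsFrobeniusAction H f.ker := fun h hh n hn => Subtype.ext <| by
    refine hfix h h.2 (fun h1 => hh (Subtype.ext h1)) n n.2 (mul_inv_eq_iff_eq_mul.1 ?_)
    rw [← MulAut.conjNormal_apply]
    exact congrArg Subtype.val hn
  have := hact.isCyclic hp hHE
  rw [hH.symm.index_eq_card, hHE.card_eq hp]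

end FrobeniusGroups

section ComplementsInNormalSubgroups

variable {G : Type*} [Group G] [Finite G] {K L : Subgroup G}

theorem ncard_sdiff_mul_relIndex (hKL : K ≤ L) (hcard : L.index + 1 = K.relIndex L) :
    ((L : Set G) \ K).ncard * K.relIndex L = Nat.card G := by
  have hsdiff : ((L : Set G) \ K).ncard + Nat.card K = Nat.card L :=
    Set.ncard_sdiff_add_ncard_of_subset (SetLike.coe_subset_coe.2 hKL)
  have hL : Nat.card K * K.relIndex L = Nat.card L := by
    simpa only [Subgroup.relIndex_bot_left] using Subgroup.relIndex_mul_relIndex ⊥ K L bot_le hKL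
  have hncard : ((L : Set G) \ K).ncard = Nat.card K * L.index := by
    rw [← hL, ← hcard] at hsdiff
    linarith
  rw [hncard, mul_right_comm, hL, L.card_mul_index]

theorem card_centralizer_eq_relIndex (hKL : K ≤ L) (hcard : L.index + 1 = K.relIndex L) {x : G}
    (hx : conjugatesOf x = (L : Set G) \ K) :
    Nat.card (Subgroup.centralizer {x}) = K.relIndex L := by
  have hne : ((L : Set G) \ K).ncard ≠ 0 :=
    left_ne_zero_of_mul (ncard_sdiff_mul_relIndex hKL hcard ▸ Nat.card_pos.ne')
  refine mul_left_cancel₀ hne ?_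
  rw [ncard_sdiff_mul_relIndex hKL hcard, ← hx, ncard_conjugatesOf_mul_card_centralizer]

theorem conjugatesOf_eq_sdiff [K.Normal] [L.Normal] (hKL : K ≤ L)
    (hcard : L.index + 1 = K.relIndex L) {x : G} (hxL : x ∈ L) (hxK : x ∉ K)
    (hx : Nat.card (Subgroup.centralizer {x}) ≤ K.relIndex L) :
    conjugatesOf x = (L : Set G) \ K := by
  have hsub : conjugatesOf x ⊆ (L : Set G) \ K := by
    refine fun y hy => ⟨Group.conjugates_subset_normal hxL hy, fun hyK => hxK ?_⟩
    exact Group.conjugates_subset_normal hyK (IsConj.symm hy)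
  refine Set.eq_of_subset_of_ncard_le hsub ?_ (Set.toFinite _)
  refine Nat.le_of_mul_le_mul_right ?_ (Nat.card_pos (α := Subgroup.centralizer {x}))
  calc ((L : Set G) \ K).ncard * Nat.card (Subgroup.centralizer {x})
      ≤ ((L : Set G) \ K).ncard * K.relIndex L := Nat.mul_le_mul_left _ hx
    _ = (conjugatesOf x).ncard * Nat.card (Subgroup.centralizer {x}) := by
      rw [ncard_sdiff_mul_relIndex hKL hcard, ncard_conjugatesOf_mul_card_centralizer]

end ComplementsInNormalSubgroups

section TwoFrobeniusGroups

theorem IsTwoFrobenius.ne_bot {G : Type*} [Group G] {K L : Subgroup G} [K.Normal]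
    (h : IsTwoFrobenius K L) : K ≠ ⊥ := by
  rintro rfl
  exact h.2.2.1.2.1 (Subgroup.bot_subgroupOf L)

variable {G : Type*} [Group G] [Finite G] {K : Subgroup G} [K.Normal]

theorem isFrobeniusWithKernel_subgroupOf {L : Subgroup G} (hK : K ≠ ⊥) (hKL : K ≤ L)
    (hcard : L.index + 1 = K.relIndex L) (hcoprime : (Nat.card K).Coprime (K.relIndex L)) {g : G}
    (hg : conjugatesOf g = (L : Set G) \ K) : IsFrobeniusWithKernel (K.subgroupOf L) := by
  have hfix : ∀ x ∈ L, x ∉ K → ∀ k ∈ K, Commute x k → k = 1 := by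
    intro x hxL hxK k hk hcomm
    have hgx : IsConj g x := hg.symm.subset ⟨hxL, hxK⟩
    have hcent : Nat.card (Subgroup.centralizer {x}) = K.relIndex L :=
      card_centralizer_eq_relIndex hKL hcard (hgx.conjugatesOf_eq ▸ hg)
    refine Subgroup.disjoint_def.1 (Subgroup.disjoint_of_coprime_natCard (hcent ▸ hcoprime)) hk ?_
    exact Subgroup.mem_centralizer_singleton_iff.2 hcomm.symm
  refine isFrobeniusWithKernel_of_coprime ?_ ?_ ?_ fun x hx k hk hcomm => Subtype.ext ?_
  · rw [Ne, Subgroup.subgroupOf_eq_bot]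
    exact fun h => hK (h.eq_bot_of_le hKL)
  · intro h
    have : L.index = 0 := by simpa [Subgroup.relIndex, h] using hcard
    exact Subgroup.index_ne_zero_of_finite this
  · rwa [Nat.card_congr (Subgroup.subgroupOfEquivOfLe hKL).toEquiv]
  · exact hfix x x.2 hx k hk (hcomm.map L.subtype)

theorem relIndex_eq_of_isElementaryAbelian_map {L : Subgroup G} {p : ℕ} (hp : p.Prime)
    (hE : IsElementaryAbelian p (L.map (QuotientGroup.mk' K)))
    (hK : IsFrobeniusWithKernel (K.subgroupOf L)) : K.relIndex L = p := by
  have hker : ((QuotientGroup.mk' K).subgroupMap L).ker = K.subgroupOf L := by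
    rw [Subgroup.ker_subgroupMap, QuotientGroup.ker_mk']
  rw [Subgroup.relIndex, ← hker]
  exact IsFrobeniusWithKernel.index_ker_eq hp (hker ▸ hK) hE

namespace IsTwoFrobenius

variable {L : Subgroup G}

theorem eq_one_of_commute (h : IsTwoFrobenius K L) {g k : G} (hgL : g ∈ L) (hgK : g ∉ K)
    (hk : k ∈ K) (hcomm : Commute g k) : k = 1 := by
  obtain ⟨-, hKL, hfrob, -⟩ := h
  have hsub : Commute (⟨g, hgL⟩ : L) ⟨k, hKL hk⟩ := Subtype.ext hcomm
  exact congrArg Subtype.val (hfrob.eq_one_of_commute (n := ⟨k, hKL hk⟩) hgK hk hsub)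

theorem centralizer_le (h : IsTwoFrobenius K L) {g : G} (hgL : g ∈ L) (hgK : g ∉ K) :
    Subgroup.centralizer {g} ≤ L := by
  obtain ⟨-, hKL, -, hfrob⟩ := h
  intro x hx
  have hcomm : Commute x g := Subgroup.mem_centralizer_singleton_iff.1 hx
  have hxL : QuotientGroup.mk' K x ∈ L.map (QuotientGroup.mk' K) := by
    by_contra hxL
    refine hgK ((QuotientGroup.eq_one_iff g).1 ?_)
    exact hfrob.eq_one_of_commute hxL (Subgroup.mem_map_of_mem _ hgL) (hcomm.map _)
  rwa [← Subgroup.mem_comap, Subgroup.comap_map_eq_self] at hxL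
  rwa [QuotientGroup.ker_mk']

theorem card_centralizer_le (h : IsTwoFrobenius K L) {g : G} (hgL : g ∈ L) (hgK : g ∉ K) :
    Nat.card (Subgroup.centralizer {g}) ≤ K.relIndex L := by
  have hinf : K ⊓ Subgroup.centralizer {g} = ⊥ :=
    (Subgroup.eq_bot_iff_forall _).2 fun k hk => h.eq_one_of_commute hgL hgK hk.1
      (Subgroup.mem_centralizer_singleton_iff.1 hk.2).symm
  calc Nat.card (Subgroup.centralizer {g})
      = K.relIndex (Subgroup.centralizer {g}) := by
        rw [← Subgroup.inf_relIndex_right, hinf, Subgroup.relIndex_bot_left]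
    _ ≤ K.relIndex L :=
      Subgroup.relIndex_le_of_le_right (h.centralizer_le hgL hgK)
        Subgroup.index_ne_zero_of_finite

theorem isolatedCharWithKernel (h : IsTwoFrobenius K (commutator G))
    (hcard : (commutator G).index + 1 = K.relIndex (commutator G)) :
    IsolatedCharWithKernel G K := by
  obtain ⟨-, hKL, ⟨-, -, C, hCbot, hKC, -⟩, -⟩ := id h
  have hCK : ∀ x ∈ C.map (commutator G).subtype, x ≠ 1 → x ∈ commutator G ∧ x ∉ K := by
    rintro _ ⟨x, hx, rfl⟩ hx1
    refine ⟨x.2, fun hxK => hx1 ?_⟩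
    exact congrArg Subtype.val (Subgroup.disjoint_def.1 hKC.disjoint hxK hx)
  have hmap : C.map (commutator G).subtype ≠ ⊥ :=
    (Subgroup.map_eq_bot_iff_of_injective _ (Subgroup.subtype_injective _)).not.2 hCbot
  obtain ⟨g, hgC, hg⟩ := (Subgroup.bot_or_exists_ne_one _).resolve_left hmap
  obtain ⟨hgL, hgK⟩ := hCK g hgC hg
  have hcent := h.card_centralizer_le hgL hgK
  have hconj := conjugatesOf_eq_sdiff hKL hcard hgL hgK hcent
  obtain ⟨χ, hχ⟩ := exists_isIsolatedAt hg hgL hgC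
    (fun x hx hx1 => hconj.symm.subset (hCK x hx hx1)) (hcent.trans_eq hcard.symm)
  refine ⟨g, χ, fun hcenter => h.ne_bot ?_, hχ.1, hχ.2.1, hχ.2.2,
    (hχ.forall_mem_iff hg).2 ⟨hKL, hconj⟩⟩
  refine (Subgroup.eq_bot_iff_forall K).2 fun k hk => h.eq_one_of_commute hgL hgK hk ?_
  exact (Subgroup.mem_center_iff.1 hcenter k).symm

end IsTwoFrobenius

end TwoFrobeniusGroups

theorem mainTheorem12 {G : Type*} [Group G] [Finite G] (K : Subgroup G) [K.Normal]
    (p : ℕ) (hp : p.Prime) :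
    (∀ m : ℕ, 1 ≤ m →
      IsolatedCharWithKernel G K →
      IsFrobeniusWithKernel ((commutator G).map (QuotientGroup.mk' K)) →
      IsElementaryAbelian p ((commutator G).map (QuotientGroup.mk' K)) →
      Nat.card ((commutator G).map (QuotientGroup.mk' K)) = p ^ m →
      IsCyclic (G ⧸ commutator G) →
      Nat.card (G ⧸ commutator G) = p ^ m - 1 →
      K ≠ ⊥ →
      ¬ p ∣ Nat.card K →
      IsTwoFrobenius K (commutator G) ∧ m = 1) ∧
    (IsTwoFrobenius K (commutator G) →
      K.relIndex (commutator G) = p →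
      IsCyclic (G ⧸ commutator G) →
      Nat.card (G ⧸ commutator G) = p - 1 →
      IsolatedCharWithKernel G K) := by
  refine ⟨fun m _ hiso hfrob hE hcard _ hquot hK hpK => ?_, fun h hcard _ hquot => ?_⟩
  · obtain ⟨hKL, g, hg⟩ := hiso.exists_conjugatesOf_eq
    rw [← Subgroup.relIndex_ker, QuotientGroup.ker_mk'] at hcard
    have hcoprime : (Nat.card K).Coprime (K.relIndex (commutator G)) :=
      hcard ▸ ((hp.coprime_iff_not_dvd.2 hpK).symm.pow_right m)
    have hindex : (commutator G).index + 1 = K.relIndex (commutator G) := by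
      rw [Subgroup.index, hquot, hcard, Nat.sub_add_cancel (Nat.pow_pos hp.pos)]
    have hfrobK := isFrobeniusWithKernel_subgroupOf hK hKL hindex hcoprime hg
    have hrel := relIndex_eq_of_isElementaryAbelian_map hp hE hfrobK
    refine ⟨⟨inferInstance, hKL, hfrobK, hfrob⟩, Nat.pow_right_injective hp.two_le ?_⟩
    simpa only [pow_one] using hcard.symm.trans hrel
  · refine h.isolatedCharWithKernel ?_
    rw [Subgroup.index, hquot, hcard, Nat.sub_add_cancel hp.pos]
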